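/- There is a universal constant $C>0$ such that the following holds. Let $A_0\in\mathbb C^{n\times n}$ be unitary ($A_0^*A_0=\mathrm{Id}$) with rows $a_1^*,\dots,a_n^*$, let $s\ge 2$, let $S\subset\{1,\dots,n\}$ have cardinality $s$, let $x\in\mathbb C^n$ be supported on $S$ (that is, $x_i=0$ for $i\notin S$), and let $\varepsilon\in(0,1)$. A drawing distribution is a vector $\pi=(\pi_k)_{1\le k\le n}$ with $\pi_k>0$ and $\sum_k\pi_k=1$. Given $\pi$, let $K_1,\dots,K_m$ be i.i.d. with $\mathbb P(K_\ell=k)=\pi_k$ for $1\le k\le n$, and let $A=\frac1{\sqrt m}\Big(\frac1{\sqrt{\pi_{K_\ell}}}a_{K_\ell}^*\Big)_{1\le\ell\le m}\in\mathbb C^{m\times n}$. (i) For every drawing distribution $\pi$, if $$m\ \ge\ C\,s\,\max_{1\le k\le n}\frac{\|a_k\|_\infty^2}{\pi_k}\,\ln(s)\,\ln\Big(\frac n\varepsilon\Big),$$ then with probability at least $1-\varepsilon$ the vector $x$ is the unique solution of $\min\{\|z\|_1 : z\in\mathbb C^n,\ Az=Ax\}$. (ii) The right-hand side of this condition, as a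 function of the drawing distribution $\pi$, is minimized exactly at $\pi^\star_k=\|a_k\|_\infty^2\big/\sum_{\ell=1}^n\|a_\ell\|_\infty^2$, and its minimal value is $C\,s\sum_{k=1}^n\|a_k\|_\infty^2\,\ln(s)\ln(n/\varepsilon)$. In particular, when $\pi=\pi^\star$, if $$m\ \ge\ C\,s\sum_{k=1}^n\|a_k\|_\infty^2\,\ln(s)\,\ln\Big(\frac n\varepsilon\Big),$$ then $x$ is the unique solution of $\min\{\|z\|_1 : Az=Ax\}$ with probability at least $1-\varepsilon$. -/

import Mathlib

universe u

open MeasureTheory ProbabilityTheory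

noncomputable section

namespace IsolatedSensing

/-- The `k`-th measurement vector `a_k ∈ ℂⁿ`: its conjugate transpose `a_k^*` is the `k`-th row of
`A₀`. -/
def measVec {n : ℕ} (A₀ : Matrix (Fin n) (Fin n) ℂ) (k : Fin n) : Fin n → ℂ :=
  fun j => star (A₀ k j)

/-- The `ℓ^∞` norm `max_j |v_j|` on `ℂⁿ`. -/
def linftyNorm {n : ℕ} (v : Fin n → ℂ) : ℝ := ⨆ j, ‖v j‖

/-- The `ℓ¹` norm on `ℂⁿ`. -/
def l1Norm {n : ℕ} (v : Fin n → ℂ) : ℝ := ∑ j, ‖v j‖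

/-- A drawing distribution on the `n` rows. All probabilities are positive: they are divided by. -/
structure IsDrawingDistribution {n : ℕ} (π : Fin n → ℝ) : Prop where
  pos : ∀ k, 0 < π k
  sum_eq_one : ∑ k, π k = 1

/-- `K₁, …, K_m` are i.i.d. random row indices with `P(K_ℓ = k) = π_k`. -/
structure IsIIDDraw {Ω : Type*} [MeasurableSpace Ω] (P : Measure Ω) {n m : ℕ}
    (π : Fin n → ℝ) (K : Fin m → Ω → Fin n) : Prop where
  measurable : ∀ l, Measurable (K l)
  indep : iIndepFun K P
  law : ∀ l k, P.real {ω | K l ω = k} = π k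

/-- The sensing matrix whose `ℓ`-th row is `a_{κ ℓ}^* / (√m √π_{κ ℓ})`, for the drawn row
indices `κ`. -/
def sensingMatrix {n m : ℕ} (A₀ : Matrix (Fin n) (Fin n) ℂ) (π : Fin n → ℝ)
    (κ : Fin m → Fin n) : Matrix (Fin m) (Fin n) ℂ :=
  fun l j => ((1 / √(m : ℝ) * (1 / √(π (κ l))) : ℝ) : ℂ) * star (measVec A₀ (κ l) j)

/-- `z` solves `min ‖w‖₁` subject to `A w = y`. -/
def IsL1Solution {n m : ℕ} (A : Matrix (Fin m) (Fin n) ℂ) (y : Fin m → ℂ) (z : Fin n → ℂ) :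
    Prop :=
  A.mulVec z = y ∧ ∀ w, A.mulVec w = y → l1Norm z ≤ l1Norm w

/-- `x` is the unique solution of `min ‖w‖₁` subject to `A w = A x`. -/
def IsUniqueL1Solution {n m : ℕ} (A : Matrix (Fin m) (Fin n) ℂ) (x : Fin n → ℂ) : Prop :=
  ∀ z, IsL1Solution A (A.mulVec x) z ↔ z = x

/-- The bound `C s max_k (‖a_k‖_∞² / π_k) ln s ln (n / ε)` on the number of measurements. -/
def measurementBound {n : ℕ} (C : ℝ) (s : ℕ) (ε : ℝ) (A₀ : Matrix (Fin n) (Fin n) ℂ)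
    (π : Fin n → ℝ) : ℝ :=
  C * s * (⨆ k, linftyNorm (measVec A₀ k) ^ 2 / π k) * Real.log s * Real.log (n / ε)

/-- The drawing distribution proportional to `‖a_k‖_∞²`. -/
def optimalDrawing {n : ℕ} (A₀ : Matrix (Fin n) (Fin n) ℂ) (k : Fin n) : ℝ :=
  linftyNorm (measVec A₀ k) ^ 2 / ∑ l, linftyNorm (measVec A₀ l) ^ 2

end IsolatedSensing

end

/-! Recovery rests on approximate dual certificates built by golfing in the sup norm. Let `B` be the
maximum of `‖a_k‖_∞² / π_k`. For a fixed `q` supported on `S` with entries at most `Q`, the mean of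
`M` sampled terms `π_k⁻¹ ⟨a_k, q⟩ a_k` has expectation `q`. Bernstein's inequality puts every
coordinate within `Q / 4` of `q` once `M` is of order `B s ln (n / ε)` (`weight_blockMean_far_le`).
Applying a fresh block to the residual on `S` divides it by 4 each time, while the errors off `S`
add up to a geometric series bounded by `Q / 3` (`weight_no_certificate_le`). About `log₂ s` blocks
bring the residual below `1 / (4 s)`; this is the source of the factor `ln s`.

Certificates are needed for only `s + 1` fixed targets: the sign of `x` and the coordinate vectors
`e_j`, `j ∈ S`. For `h` in the kernel, those for the `e_j` bound the mass of `h` on `S` by its mass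
off `S`, replacing the usual local isometry estimate; the one for the sign then makes `‖x + h‖₁`
exceed `‖x‖₁` (`l1Norm_lt_of_certificates`). A union bound over targets, blocks and coordinates
gives the probability (`failure_bound`).

Optimality of `π⋆` holds because it makes all the ratios equal, and any other distribution is
smaller than `π⋆` at some index (`sum_lt_iSup_div`). Probabilities are handled as weighted sums over
finite words and transferred to the sample space by `measureReal_blocks_le`. -/

namespace IsolatedSensing

/-! ### Weighted counting on finite types -/

/-- The total mass that the weight function `p` gives to `E`. -/
noncomputable def weight {α : Type*} [Fintype α] (p : α → ℝ) (E : Set α) : ℝ :=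
  ∑ a, E.indicator p a

/-- The product weight on words of length `L`. -/
noncomputable def prodWeight {α : Type*} (p : α → ℝ) (L : ℕ) (b : Fin L → α) : ℝ :=
  ∏ i, p (b i)

theorem prodWeight_nonneg {α : Type*} {p : α → ℝ} (hp : ∀ a, 0 ≤ p a) (L : ℕ)
    (b : Fin L → α) : 0 ≤ prodWeight p L b :=
  Finset.prod_nonneg fun _ _ => hp _

theorem sum_prodWeight {α : Type*} [Fintype α] {p : α → ℝ} (hp : ∑ a, p a = 1) (L : ℕ) :
    ∑ b, prodWeight p L b = 1 := by
  unfold prodWeight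
  rw [← Fintype.sum_pow, hp, one_pow]

theorem weight_mono {α : Type*} [Fintype α] {p : α → ℝ} (hp : ∀ a, 0 ≤ p a) {E F : Set α}
    (h : E ⊆ F) : weight p E ≤ weight p F :=
  Finset.sum_le_sum fun a _ => Set.indicator_le_indicator_of_subset h hp a

/-- The union bound. -/
theorem weight_iUnion_le {α ι : Type*} [Fintype α] [Fintype ι] {p : α → ℝ} (hp : ∀ a, 0 ≤ p a)
    (E : ι → Set α) : weight p (⋃ i, E i) ≤ ∑ i, weight p (E i) := by
  unfold weight
  rw [Finset.sum_comm]
  refine Finset.sum_le_sum fun a _ => ?_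
  have hnn : ∀ i, 0 ≤ (E i).indicator p a := fun i => Set.indicator_nonneg (fun a _ => hp a) a
  by_cases h : a ∈ ⋃ i, E i
  · obtain ⟨i, hi⟩ := Set.mem_iUnion.1 h
    rw [Set.indicator_of_mem h, ← Set.indicator_of_mem hi p]
    exact Finset.single_le_sum (f := fun i => (E i).indicator p a) (fun i _ => hnn i)
      (Finset.mem_univ i)
  · rw [Set.indicator_of_notMem h]
    exact Finset.sum_nonneg fun i _ => hnn i

/-- Conditioning a word on its first letter. -/
theorem weight_prodWeight_succ_le {α : Type*} [Fintype α] {p : α → ℝ} (hp : ∀ a, 0 ≤ p a)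
    (hp1 : ∑ a, p a = 1) {L : ℕ} {E : Set (Fin (L + 1) → α)} {F : Set α}
    {G : α → Set (Fin L → α)} {η : ℝ} (hη : 0 ≤ η)
    (hE : ∀ a b, Fin.cons a b ∈ E → a ∈ F ∨ b ∈ G a)
    (hG : ∀ a, a ∉ F → weight (prodWeight p L) (G a) ≤ η) :
    weight (prodWeight p (L + 1)) E ≤ weight p F + η := by
  have hpp := prodWeight_nonneg hp L
  have hcons : ∀ a b, prodWeight p (L + 1) (Fin.cons a b) = p a * prodWeight p L b := by
    intro a b
    simp [prodWeight, Fin.prod_univ_succ]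
  have h1 : weight (prodWeight p (L + 1)) E
      = ∑ a, ∑ b : Fin L → α, E.indicator (prodWeight p (L + 1)) (Fin.cons a b) := by
    unfold weight
    rw [← Fintype.sum_prod_type', ← (Fin.consEquiv fun _ => α).sum_comp]
    rfl
  have h2 : weight p F + η = ∑ a, (F.indicator p a + p a * η) := by
    rw [Finset.sum_add_distrib, ← Finset.sum_mul, hp1, one_mul, weight]
  rw [h1, h2]
  refine Finset.sum_le_sum fun a _ => ?_
  by_cases ha : a ∈ F
  · rw [Set.indicator_of_mem ha]
    have : ∑ b : Fin L → α, E.indicator (prodWeight p (L + 1)) (Fin.cons a b)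
        ≤ ∑ b : Fin L → α, p a * prodWeight p L b :=
      Finset.sum_le_sum fun b _ => (Set.indicator_le_self' (fun b _ => prodWeight_nonneg hp _ b) _).trans
        (hcons a b).le
    rw [← Finset.mul_sum, sum_prodWeight hp1, mul_one] at this
    have := mul_nonneg (hp a) hη
    linarith
  · rw [Set.indicator_of_notMem ha, zero_add]
    refine le_trans ?_ (mul_le_mul_of_nonneg_left (hG a ha) (hp a))
    rw [weight, Finset.mul_sum]
    refine Finset.sum_le_sum fun b _ => ?_
    by_cases hb : (Fin.cons a b : Fin (L + 1) → α) ∈ E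
    · rw [Set.indicator_of_mem hb, hcons, Set.indicator_of_mem ((hE a b hb).resolve_left ha)]
    · rw [Set.indicator_of_notMem hb]
      exact mul_nonneg (hp a) (Set.indicator_nonneg (fun b _ => hpp b) b)

/-- An exponential moment bound for a bounded function with controlled second moment. -/
theorem sum_mul_exp_le {α : Type*} [Fintype α] {p : α → ℝ} (hp : ∀ a, 0 ≤ p a)
    (hp1 : ∑ a, p a = 1) {g : α → ℝ} {r V : ℝ} (hr : ∀ a, |r * g a| ≤ 1)
    (hV : ∑ a, p a * g a ^ 2 ≤ V) :
    ∑ a, p a * Real.exp (r * g a) ≤ Real.exp (r * ∑ a, p a * g a + r ^ 2 * V) := by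
  have h1 : ∀ a, p a * Real.exp (r * g a)
      ≤ p a + r * (p a * g a) + r ^ 2 * (p a * g a ^ 2) := by
    intro a
    -- This is `e^y ≤ 1 + y + y²` for `|y| ≤ 1`.
    have := (abs_le.1 (Real.abs_exp_sub_one_sub_id_le (hr a))).2
    nlinarith [hp a]
  calc ∑ a, p a * Real.exp (r * g a)
      ≤ ∑ a, (p a + r * (p a * g a) + r ^ 2 * (p a * g a ^ 2)) := Finset.sum_le_sum fun a _ => h1 a
    _ = 1 + r * ∑ a, p a * g a + r ^ 2 * ∑ a, p a * g a ^ 2 := by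
        rw [Finset.sum_add_distrib, Finset.sum_add_distrib, hp1, Finset.mul_sum, Finset.mul_sum]
    _ ≤ (r * ∑ a, p a * g a + r ^ 2 * V) + 1 := by
        nlinarith [mul_le_mul_of_nonneg_left hV (sq_nonneg r)]
    _ ≤ _ := Real.add_one_le_exp _

/-- Bernstein's inequality for product weights. -/
theorem weight_sum_gt_le {α : Type*} [Fintype α] {p : α → ℝ} (hp : ∀ a, 0 ≤ p a)
    (hp1 : ∑ a, p a = 1) {g : α → ℝ} {r V t : ℝ} (hr0 : 0 ≤ r) (hr : ∀ a, |r * g a| ≤ 1)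
    (hV : ∑ a, p a * g a ^ 2 ≤ V) (M : ℕ) :
    weight (prodWeight p M) {κ | M * (∑ a, p a * g a + t) < ∑ j, g (κ j)}
      ≤ Real.exp (M * (r ^ 2 * V - r * t)) := by
  set μ := ∑ a, p a * g a with hμ
  -- Chernoff's bound pointwise: the indicator is dominated by an exponential that factors over the
  -- letters.
  have hpt : ∀ κ : Fin M → α,
      Set.indicator {κ : Fin M → α | M * (μ + t) < ∑ j, g (κ j)} (prodWeight p M) κ
        ≤ Real.exp (-(r * (M * (μ + t)))) * ∏ j, (p (κ j) * Real.exp (r * g (κ j))) := by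
    intro κ
    rw [Finset.prod_mul_distrib, ← Real.exp_sum, ← Finset.mul_sum, mul_left_comm, ← Real.exp_add]
    have hnn : 0 ≤ ∏ j, p (κ j) := Finset.prod_nonneg fun j _ => hp _
    by_cases h : M * (μ + t) < ∑ j, g (κ j)
    · rw [Set.indicator_of_mem (by exact h)]
      refine le_mul_of_one_le_right hnn (Real.one_le_exp ?_)
      nlinarith
    · rw [Set.indicator_of_notMem (by exact h)]
      positivity
  have hexp : Real.exp (M * (r ^ 2 * V - r * t))
      = Real.exp (-(r * (M * (μ + t)))) * Real.exp (r * μ + r ^ 2 * V) ^ M := by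
    rw [← Real.exp_nat_mul, ← Real.exp_add]
    congr 1
    ring
  rw [hexp]
  refine (Finset.sum_le_sum fun κ _ => hpt κ).trans ?_
  rw [← Finset.mul_sum, ← Fintype.sum_pow fun a => p a * Real.exp (r * g a)]
  have h0 : 0 ≤ ∑ a, p a * Real.exp (r * g a) :=
    Finset.sum_nonneg fun a _ => mul_nonneg (hp a) (Real.exp_pos _).le
  gcongr
  exact sum_mul_exp_le hp hp1 hr hV

/-! ### One block of measurements -/

/-- The vector `π_k⁻¹ ⟨a_k, q⟩ a_k`, whose mean over `π` is `q`. -/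
noncomputable def sampleTerm {n : ℕ} (A₀ : Matrix (Fin n) (Fin n) ℂ) (π : Fin n → ℝ)
    (q : Fin n → ℂ) (k : Fin n) : Fin n → ℂ :=
  fun i => ((1 / π k : ℝ) : ℂ) * A₀.mulVec q k * measVec A₀ k i

theorem norm_measVec {n : ℕ} (A₀ : Matrix (Fin n) (Fin n) ℂ) (k i : Fin n) :
    ‖measVec A₀ k i‖ = ‖A₀ k i‖ := by
  simp [measVec]

theorem sum_normSq_mulVec {n : ℕ} {A₀ : Matrix (Fin n) (Fin n) ℂ}
    (hA : A₀ ∈ Matrix.unitaryGroup (Fin n) ℂ) (q : Fin n → ℂ) :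
    ∑ k, ‖A₀.mulVec q k‖ ^ 2 = ∑ j, ‖q j‖ ^ 2 := by
  have key : dotProduct (star (A₀.mulVec q)) (A₀.mulVec q) = dotProduct (star q) q := by
    rw [Matrix.star_mulVec, Matrix.dotProduct_mulVec, Matrix.vecMul_vecMul,
      ← Matrix.star_eq_conjTranspose, Matrix.mem_unitaryGroup_iff'.1 hA, Matrix.vecMul_one]
  have hself : ∀ v : Fin n → ℂ, dotProduct (star v) v = ((∑ k, ‖v k‖ ^ 2 : ℝ) : ℂ) := by
    intro v
    simp [dotProduct, Complex.conj_mul']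
  rw [hself, hself] at key
  exact_mod_cast key

theorem sum_mul_sampleTerm {n : ℕ} {A₀ : Matrix (Fin n) (Fin n) ℂ}
    (hA : A₀ ∈ Matrix.unitaryGroup (Fin n) ℂ) {π : Fin n → ℝ} (hπ : ∀ k, 0 < π k)
    (q : Fin n → ℂ) (i : Fin n) :
    ∑ k, (π k : ℂ) * sampleTerm A₀ π q k i = q i := by
  have h1 : ∀ k, (π k : ℂ) * sampleTerm A₀ π q k i = star (A₀ k i) * A₀.mulVec q k := by
    intro k
    have : (π k : ℂ) ≠ 0 := by exact_mod_cast (hπ k).ne'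
    simp only [sampleTerm, measVec]
    push_cast
    field_simp
  have h2 : (star A₀).mulVec (A₀.mulVec q) = q := by
    rw [Matrix.mulVec_mulVec, Matrix.mem_unitaryGroup_iff'.1 hA, Matrix.one_mulVec]
  calc ∑ k, (π k : ℂ) * sampleTerm A₀ π q k i = (star A₀).mulVec (A₀.mulVec q) i :=
        Finset.sum_congr rfl fun k _ => h1 k
    _ = q i := by rw [h2]

/-- By the arithmetic-geometric mean inequality, the product of two entries of row `k` is at most `B
π_k` in modulus; only the columns in `S` contribute. -/
theorem norm_sampleTerm_le {n : ℕ} {A₀ : Matrix (Fin n) (Fin n) ℂ} {π : Fin n → ℝ}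
    (hπ : ∀ k, 0 < π k) {B : ℝ} (hB : ∀ k i, ‖A₀ k i‖ ^ 2 ≤ B * π k)
    {S : Finset (Fin n)} {q : Fin n → ℂ} {Q : ℝ} (hS : ∀ i, i ∉ S → q i = 0)
    (hQ : ∀ i, ‖q i‖ ≤ Q) (k i : Fin n) :
    ‖sampleTerm A₀ π q k i‖ ≤ B * S.card * Q := by
  have hmv : A₀.mulVec q k = ∑ j ∈ S, A₀ k j * q j := by
    refine (Finset.sum_subset (Finset.subset_univ S) fun j _ hj => ?_).symm
    rw [hS j hj, mul_zero]
  have h1 : ‖A₀.mulVec q k‖ * ‖A₀ k i‖ ≤ ∑ j ∈ S, B * π k * Q := by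
    rw [hmv]
    refine (mul_le_mul_of_nonneg_right (norm_sum_le _ _) (norm_nonneg _)).trans ?_
    rw [Finset.sum_mul]
    refine Finset.sum_le_sum fun j _ => ?_
    rw [norm_mul, mul_right_comm]
    have hab : ‖A₀ k j‖ * ‖A₀ k i‖ ≤ B * π k := by
      nlinarith [hB k j, hB k i, sq_nonneg (‖A₀ k j‖ - ‖A₀ k i‖)]
    exact mul_le_mul hab (hQ j) (norm_nonneg _) ((sq_nonneg _).trans (hB k j))
  rw [Finset.sum_const, nsmul_eq_mul] at h1
  have hk := hπ k
  rw [sampleTerm, norm_mul, norm_mul, norm_measVec, Complex.norm_real, Real.norm_of_nonneg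
    (by positivity), mul_assoc, div_mul_eq_mul_div, one_mul, div_le_iff₀ hk]
  linarith

/-- One factor `|A₀ k i|² / π_k` costs `B`; the rest sums to `‖q‖₂²` by unitarity. The bound is
therefore linear in `B |S|`, where squaring the sup bound would give a quadratic one. -/
theorem sum_mul_norm_sampleTerm_sq_le {n : ℕ} {A₀ : Matrix (Fin n) (Fin n) ℂ}
    (hA : A₀ ∈ Matrix.unitaryGroup (Fin n) ℂ) {π : Fin n → ℝ}
    (hπ : ∀ k, 0 < π k) {B : ℝ} (hB0 : 0 ≤ B) (hB : ∀ k i, ‖A₀ k i‖ ^ 2 ≤ B * π k)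
    {S : Finset (Fin n)} {q : Fin n → ℂ} {Q : ℝ} (hS : ∀ i, i ∉ S → q i = 0)
    (hQ : ∀ i, ‖q i‖ ≤ Q) (i : Fin n) :
    ∑ k, π k * ‖sampleTerm A₀ π q k i‖ ^ 2 ≤ B * S.card * Q ^ 2 := by
  have h1 : ∀ k, π k * ‖sampleTerm A₀ π q k i‖ ^ 2 ≤ B * ‖A₀.mulVec q k‖ ^ 2 := by
    intro k
    have hk := hπ k
    rw [sampleTerm, norm_mul, norm_mul, norm_measVec, Complex.norm_real, Real.norm_of_nonneg
      (by positivity)]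
    have : π k * (1 / π k * ‖A₀.mulVec q k‖ * ‖A₀ k i‖) ^ 2
        = ‖A₀ k i‖ ^ 2 / π k * ‖A₀.mulVec q k‖ ^ 2 := by
      field_simp
    rw [this]
    exact mul_le_mul_of_nonneg_right ((div_le_iff₀ hk).2 (hB k i)) (sq_nonneg _)
  refine (Finset.sum_le_sum fun k _ => h1 k).trans ?_
  rw [← Finset.mul_sum, sum_normSq_mulVec hA, mul_assoc]
  refine mul_le_mul_of_nonneg_left ?_ hB0
  rw [← Finset.sum_subset (Finset.subset_univ S) (fun j _ hj => by simp [hS j hj]),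
    ← nsmul_eq_mul]
  exact Finset.sum_le_card_nsmul _ _ _ fun j _ =>
    pow_le_pow_left₀ (norm_nonneg _) (hQ j) 2

/-- The mean of the sampled terms of a block. -/
noncomputable def blockMean {n M : ℕ} (A₀ : Matrix (Fin n) (Fin n) ℂ) (π : Fin n → ℝ)
    (q : Fin n → ℂ) (κ : Fin M → Fin n) : Fin n → ℂ :=
  (1 / (M : ℂ)) • ∑ j, sampleTerm A₀ π q (κ j)

/-- The fourth roots of unity. -/
noncomputable def fourthRoot : Fin 4 → ℂ := ![1, -1, Complex.I, -Complex.I]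

theorem norm_fourthRoot (u : Fin 4) : ‖fourthRoot u‖ = 1 := by
  fin_cases u <;> simp [fourthRoot]

/-- Reduces a complex deviation to four real one-sided ones, at the cost of a factor 2. -/
theorem norm_le_of_re_fourthRoot_mul_le {z : ℂ} {t : ℝ}
    (h : ∀ u, (fourthRoot u * z).re ≤ t) : ‖z‖ ≤ 2 * t := by
  have h0 := h 0
  have h1 := h 1
  have h2 := h 2
  have h3 := h 3
  simp [fourthRoot] at h0 h1 h2 h3
  have hre : |z.re| ≤ t := abs_le.2 ⟨by linarith, by linarith⟩
  have him : |z.im| ≤ t := abs_le.2 ⟨by linarith, by linarith⟩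
  linarith [Complex.norm_le_abs_re_add_abs_im z]

/-- For a fixed vector `q` supported on `S`, a block of `M` draws moves no coordinate of `q` by more
than a quarter of its sup norm, except with exponentially small probability. -/
theorem weight_blockMean_far_le {n : ℕ} {A₀ : Matrix (Fin n) (Fin n) ℂ}
    (hA : A₀ ∈ Matrix.unitaryGroup (Fin n) ℂ) {π : Fin n → ℝ}
    (hπ : IsDrawingDistribution π) {B : ℝ} (hB : ∀ k i, ‖A₀ k i‖ ^ 2 ≤ B * π k)
    {S : Finset (Fin n)} (hSB : 0 < B * S.card) {q : Fin n → ℂ} {Q : ℝ} (hQ0 : 0 < Q)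
    (hS : ∀ i, i ∉ S → q i = 0) (hQ : ∀ i, ‖q i‖ ≤ Q) {M : ℕ} (hM : 0 < M) :
    weight (prodWeight π M) {κ | ∃ i, Q / 4 < ‖blockMean A₀ π q κ i - q i‖}
      ≤ 4 * n * Real.exp (-(M / (256 * (B * S.card)))) := by
  have hp : ∀ k, 0 ≤ π k := fun k => (hπ.pos k).le
  have hB0 : 0 ≤ B := by
    by_contra h
    nlinarith [Nat.cast_nonneg (α := ℝ) S.card]
  set D := B * S.card with hD
  let E : Fin n × Fin 4 → Set (Fin M → Fin n) := fun w =>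
    {κ | M * (∑ k, π k * (fourthRoot w.2 * sampleTerm A₀ π q k w.1).re + Q / 8)
      < ∑ j, (fourthRoot w.2 * sampleTerm A₀ π q (κ j) w.1).re}
  have hmean : ∀ i u, ∑ k, π k * (fourthRoot u * sampleTerm A₀ π q k i).re
      = (fourthRoot u * q i).re := by
    intro i u
    rw [← sum_mul_sampleTerm hA hπ.pos q i, Finset.mul_sum, Complex.re_sum]
    refine Finset.sum_congr rfl fun k _ => ?_
    rw [mul_left_comm, Complex.re_ofReal_mul]
  have hM' : (0 : ℝ) < M := by exact_mod_cast hM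
  have hsub : {κ : Fin M → Fin n | ∃ i, Q / 4 < ‖blockMean A₀ π q κ i - q i‖} ⊆ ⋃ w, E w := by
    rintro κ ⟨i, hi⟩
    by_contra hn
    simp only [Set.mem_iUnion, not_exists, E, Set.mem_ofPred_eq, not_lt] at hn
    refine absurd hi (not_lt.2 ?_)
    have : ‖blockMean A₀ π q κ i - q i‖ ≤ 2 * (Q / 8) := by
      refine norm_le_of_re_fourthRoot_mul_le fun u => ?_
      have h := hn (i, u)
      simp only [hmean] at h
      have hbm : blockMean A₀ π q κ i
          = ((1 / M : ℝ) : ℂ) * ∑ j, sampleTerm A₀ π q (κ j) i := by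
        simp [blockMean]
      rw [mul_sub, Complex.sub_re, hbm, mul_left_comm, Complex.re_ofReal_mul, Finset.mul_sum,
        Complex.re_sum, sub_le_iff_le_add, div_mul_eq_mul_div, one_mul, div_le_iff₀ hM']
      linarith
    linarith
  have hE : ∀ w, weight (prodWeight π M) (E w) ≤ Real.exp (-(M / (256 * D))) := by
    rintro ⟨i, u⟩
    have hre : ∀ k, |(fourthRoot u * sampleTerm A₀ π q k i).re| ≤ ‖sampleTerm A₀ π q k i‖ := by
      intro k
      refine (Complex.abs_re_le_norm _).trans ?_
      rw [norm_mul, norm_fourthRoot, one_mul]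
    have hV : ∑ k, π k * (fourthRoot u * sampleTerm A₀ π q k i).re ^ 2 ≤ D * Q ^ 2 := by
      refine le_trans (Finset.sum_le_sum fun k _ => ?_)
        (sum_mul_norm_sampleTerm_sq_le hA hπ.pos hB0 hB hS hQ i)
      refine mul_le_mul_of_nonneg_left ?_ (hp k)
      rw [← sq_abs]
      exact pow_le_pow_left₀ (abs_nonneg _) (hre k) 2
    have hr : ∀ k, |1 / (16 * D * Q) * (fourthRoot u * sampleTerm A₀ π q k i).re| ≤ 1 := by
      intro k
      rw [abs_mul, abs_of_pos (by positivity), div_mul_eq_mul_div, one_mul,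
        div_le_one (by positivity)]
      have := (hre k).trans (norm_sampleTerm_le hπ.pos hB hS hQ k i)
      have : 0 < D * Q := by positivity
      linarith
    -- With `V = D Q²`, the choice `r = t / (2 V)` minimizes `r² V - r t`, whose value is then `-1 /
    -- (256 D)`. The deviation `t` is half of `Q / 4` because of the factor 2 above.
    refine (weight_sum_gt_le hp hπ.sum_eq_one (r := 1 / (16 * D * Q)) (t := Q / 8)
      (by positivity) hr hV M).trans (le_of_eq ?_)
    congr 1
    field_simp
    ring
  have hpp := prodWeight_nonneg hp M
  refine (weight_mono hpp hsub).trans ((weight_iUnion_le hpp E).trans ?_)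
  refine (Finset.sum_le_sum fun w _ => hE w).trans (le_of_eq ?_)
  simp [Fintype.card_prod]
  ring

/-! ### Approximate dual certificates -/

/-- `v` agrees with `q` on `S` up to `δ` and is at most `η` off `S`. -/
structure IsApproxCertificate {n : ℕ} (S : Finset (Fin n)) (q v : Fin n → ℂ) (δ η : ℝ) : Prop where
  on_support : ∀ i ∈ S, ‖v i - q i‖ ≤ δ
  off_support : ∀ i, i ∉ S → ‖v i‖ ≤ η

/-- The span of the measurement vectors drawn in the blocks `b`. -/
noncomputable def drawnSpan {n M L : ℕ} (A₀ : Matrix (Fin n) (Fin n) ℂ)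
    (b : Fin L → Fin M → Fin n) : Submodule ℂ (Fin n → ℂ) :=
  Submodule.span ℂ {a | ∃ l j, a = measVec A₀ (b l j)}

theorem blockMean_mem_drawnSpan {n M L : ℕ} (A₀ : Matrix (Fin n) (Fin n) ℂ) (π : Fin n → ℝ)
    (q : Fin n → ℂ) (b : Fin L → Fin M → Fin n) (l : Fin L) :
    blockMean A₀ π q (b l) ∈ drawnSpan A₀ b := by
  refine Submodule.smul_mem _ _ (Submodule.sum_mem _ fun j _ => ?_)
  have : sampleTerm A₀ π q (b l j)
      = (((1 / π (b l j) : ℝ) : ℂ) * A₀.mulVec q (b l j)) • measVec A₀ (b l j) := by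
    ext i
    simp [sampleTerm]
  rw [this]
  exact Submodule.smul_mem _ _ (Submodule.subset_span ⟨l, j, rfl⟩)

/-- The golfing scheme. -/
theorem weight_no_certificate_le {n : ℕ} {A₀ : Matrix (Fin n) (Fin n) ℂ}
    (hA : A₀ ∈ Matrix.unitaryGroup (Fin n) ℂ) {π : Fin n → ℝ}
    (hπ : IsDrawingDistribution π) {B : ℝ} (hB : ∀ k i, ‖A₀ k i‖ ^ 2 ≤ B * π k)
    {S : Finset (Fin n)} (hSB : 0 < B * S.card) {M : ℕ} (hM : 0 < M) (L : ℕ) :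
    ∀ {q : Fin n → ℂ} {Q : ℝ}, 0 < Q → (∀ i, i ∉ S → q i = 0) → (∀ i, ‖q i‖ ≤ Q) →
    weight (prodWeight (prodWeight π M) L)
      {b | ¬ ∃ v ∈ drawnSpan A₀ b, IsApproxCertificate S q v (Q / 4 ^ L) (Q / 3)}
      ≤ L * (4 * n * Real.exp (-(M / (256 * (B * S.card))))) := by
  have hp : ∀ k, 0 ≤ π k := fun k => (hπ.pos k).le
  -- The target `q` stays quantified, since the induction hypothesis is applied to a residual that
  -- depends on the first block.
  induction L with
  | zero =>
    intro q Q hQ0 hS hQ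
    have : {b : Fin 0 → Fin M → Fin n | ¬ ∃ v ∈ drawnSpan A₀ b,
        IsApproxCertificate S q v (Q / 4 ^ 0) (Q / 3)} = ∅ := by
      refine Set.eq_empty_of_forall_notMem fun b hb => hb ⟨0, Submodule.zero_mem _, ?_, ?_⟩
      · intro i _
        simpa using hQ i
      · intro i _
        simp only [Pi.zero_apply, norm_zero]
        positivity
    rw [this]
    simp [weight]
  | succ L ih =>
    intro q Q hQ0 hS hQ
    -- The residual is truncated to `S`: what the block mean leaves off `S` is not corrected but
    -- charged to the off-support budget.
    let q' : (Fin M → Fin n) → Fin n → ℂ := fun κ i =>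
      if i ∈ S then q i - blockMean A₀ π q κ i else 0
    have key := weight_prodWeight_succ_le (p := prodWeight π M) (prodWeight_nonneg hp M)
      (sum_prodWeight hπ.sum_eq_one M) (L := L)
      (E := {b | ¬ ∃ v ∈ drawnSpan A₀ b, IsApproxCertificate S q v (Q / 4 ^ (L + 1)) (Q / 3)})
      (F := {κ | ∃ i, Q / 4 < ‖blockMean A₀ π q κ i - q i‖})
      (G := fun κ => {b | ¬ ∃ v ∈ drawnSpan A₀ b,
        IsApproxCertificate S (q' κ) v (Q / 4 / 4 ^ L) (Q / 4 / 3)})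
      (η := L * (4 * n * Real.exp (-(M / (256 * (B * S.card)))))) (by positivity) ?_ ?_
    · refine key.trans ?_
      have := weight_blockMean_far_le hA hπ hB hSB hQ0 hS hQ hM
      push_cast
      linarith
    · intro κ b hb
      by_contra hn
      obtain ⟨hfar, hcert⟩ := not_or.1 hn
      have hnear : ∀ i, ‖blockMean A₀ π q κ i - q i‖ ≤ Q / 4 := fun i =>
        not_lt.1 fun h => hfar ⟨i, h⟩
      obtain ⟨v, hv, hv1, hv2⟩ := not_not.1 hcert
      refine hb ⟨blockMean A₀ π q κ + v, ?_, ?_, ?_⟩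
      · refine Submodule.add_mem _ ?_ (Submodule.span_mono ?_ hv)
        · simpa using blockMean_mem_drawnSpan A₀ π q (Fin.cons κ b : Fin (L + 1) → _) 0
        · rintro a ⟨l, j, rfl⟩
          exact ⟨l.succ, j, by simp⟩
      · intro i hi
        have h := hv1 i hi
        simp only [q', if_pos hi] at h
        rw [pow_succ', ← div_div]
        refine le_of_eq_of_le (congrArg _ ?_) h
        simp only [Pi.add_apply]
        ring
      -- The budget closes since `Q / 4 + (Q / 4) / 3 = Q / 3`.
      · intro i hi
        have h1 := hnear i
        rw [hS i hi, sub_zero] at h1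
        have h2 := hv2 i hi
        refine (norm_add_le _ _).trans ?_
        linarith
    · intro κ hκ
      simp only [Set.mem_ofPred_eq, not_exists, not_lt] at hκ
      refine ih (by positivity) (fun i hi => if_neg hi) fun i => ?_
      by_cases hi : i ∈ S
      · simp only [q', if_pos hi]
        rw [norm_sub_rev]
        exact hκ i
      · simp only [q', if_neg hi, norm_zero]
        positivity

/-! ### Uniqueness from approximate certificates -/

/-- The entrywise sign `x_i / |x_i|`, with sign `0` at `0`. -/
noncomputable def signVec {n : ℕ} (x : Fin n → ℂ) (i : Fin n) : ℂ := x i / (‖x i‖ : ℂ)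

theorem norm_signVec_le {n : ℕ} (x : Fin n → ℂ) (i : Fin n) : ‖signVec x i‖ ≤ 1 := by
  rw [signVec, norm_div, Complex.norm_real, norm_norm]
  exact div_self_le_one _

/-- The sign is a subgradient of the modulus; where `x` vanishes the value `0` is an admissible one.
-/
theorem norm_add_re_star_signVec_mul_le {n : ℕ} (x h : Fin n → ℂ) (i : Fin n) :
    ‖x i‖ + (star (signVec x i) * h i).re ≤ ‖x i + h i‖ := by
  by_cases hx : x i = 0
  · simp [signVec, hx]
  have hx' : (‖x i‖ : ℂ) ≠ 0 := by exact_mod_cast norm_ne_zero_iff.2 hx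
  have h1 : star (signVec x i) * x i = (‖x i‖ : ℂ) := by
    simp only [signVec, star_div₀, RCLike.star_def, Complex.conj_ofReal]
    rw [div_mul_eq_mul_div, div_eq_iff hx', Complex.conj_mul', sq]
  calc ‖x i‖ + (star (signVec x i) * h i).re = (star (signVec x i) * (x i + h i)).re := by
        rw [mul_add, h1, Complex.add_re, Complex.ofReal_re]
    _ ≤ ‖star (signVec x i) * (x i + h i)‖ := Complex.re_le_norm _
    _ ≤ ‖x i + h i‖ := by
        rw [norm_mul, norm_star]
        exact mul_le_of_le_one_left (norm_nonneg _) (norm_signVec_le x i)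

/-- Orthogonality of `v` and `h` trades the pairing of `q` with `h` on `S` for the two error terms
of the certificate. -/
theorem norm_sum_star_mul_le_of_certificate {n : ℕ} {S : Finset (Fin n)} {q v h : Fin n → ℂ}
    {δ η : ℝ} (hv : IsApproxCertificate S q v δ η) (hvh : ∑ i, star (v i) * h i = 0) :
    ‖∑ i ∈ S, star (q i) * h i‖ ≤ δ * ∑ i ∈ S, ‖h i‖ + η * ∑ i ∈ Sᶜ, ‖h i‖ := by
  have hsplit : ∑ i ∈ S, star (q i) * h i
      = -(∑ i ∈ S, star (v i - q i) * h i + ∑ i ∈ Sᶜ, star (v i) * h i) := by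
    rw [← Finset.sum_add_sum_compl S] at hvh
    simp only [star_sub, sub_mul, Finset.sum_sub_distrib]
    linear_combination hvh
  rw [hsplit, norm_neg, Finset.mul_sum, Finset.mul_sum]
  refine (norm_add_le _ _).trans (add_le_add ?_ ?_)
  · refine (norm_sum_le _ _).trans (Finset.sum_le_sum fun i hi => ?_)
    rw [norm_mul, norm_star]
    exact mul_le_mul_of_nonneg_right (hv.on_support i hi) (norm_nonneg _)
  · refine (norm_sum_le _ _).trans (Finset.sum_le_sum fun i hi => ?_)
    rw [norm_mul, norm_star]
    exact mul_le_mul_of_nonneg_right (hv.off_support i (Finset.mem_compl.1 hi)) (norm_nonneg _)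

/-- Let `a` and `c` be the masses of `h` on and off `S`. Summing the coordinate certificates gives
`a ≤ a / 4 + |S| c / 3`, so `c = 0` would force `h = 0`. The sign certificate limits the loss on `S`
to `4 c / 9`, less than the gain `c` off `S`. -/
theorem l1Norm_lt_of_certificates {n : ℕ} {S : Finset (Fin n)} (hS0 : 0 < S.card)
    {x h : Fin n → ℂ} (hx : ∀ i, i ∉ S → x i = 0) (hh : h ≠ 0) {V : Submodule ℂ (Fin n → ℂ)}
    (hV : ∀ v ∈ V, ∑ i, star (v i) * h i = 0)
    (hsign : ∃ v ∈ V, IsApproxCertificate S (signVec x) v (1 / (4 * S.card)) (1 / 3))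
    (hcoord : ∀ j ∈ S, ∃ v ∈ V,
      IsApproxCertificate S (Pi.single j 1) v (1 / (4 * S.card)) (1 / 3)) :
    l1Norm x < l1Norm (x + h) := by
  set a := ∑ i ∈ S, ‖h i‖ with ha
  set c := ∑ i ∈ Sᶜ, ‖h i‖ with hc
  have hs : (0 : ℝ) < S.card := by exact_mod_cast hS0
  have hj : ∀ j ∈ S, ‖h j‖ ≤ 1 / (4 * S.card) * a + 1 / 3 * c := by
    intro j hj
    obtain ⟨v, hv, hcert⟩ := hcoord j hj
    have := norm_sum_star_mul_le_of_certificate hcert (hV v hv)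
    rwa [Finset.sum_eq_single_of_mem j hj fun i _ hij => by simp [hij], Pi.single_eq_same,
      star_one, one_mul] at this
  have hac : a ≤ 1 / 4 * a + S.card / 3 * c := by
    refine (Finset.sum_le_card_nsmul _ _ _ hj).trans (le_of_eq ?_)
    rw [nsmul_eq_mul]
    field_simp
  have hc0 : 0 ≤ c := Finset.sum_nonneg fun _ _ => norm_nonneg _
  have hcpos : 0 < c := by
    refine lt_of_le_of_ne hc0 fun h0 => hh ?_
    rw [← h0] at hac
    have ha0 : a = 0 := le_antisymm (by linarith) (Finset.sum_nonneg fun _ _ => norm_nonneg _)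
    ext i
    by_cases hi : i ∈ S
    · exact norm_eq_zero.1 ((Finset.sum_eq_zero_iff_of_nonneg fun _ _ => norm_nonneg _).1 ha0 i hi)
    · exact norm_eq_zero.1 ((Finset.sum_eq_zero_iff_of_nonneg fun _ _ => norm_nonneg _).1 h0.symm i
        (Finset.mem_compl.2 hi))
  obtain ⟨v, hv, hcert⟩ := hsign
  have hσ := norm_sum_star_mul_le_of_certificate hcert (hV v hv)
  have hσ' : -(1 / (4 * S.card) * a + 1 / 3 * c) ≤ (∑ i ∈ S, star (signVec x i) * h i).re :=
    (abs_le.1 ((Complex.abs_re_le_norm _).trans hσ)).1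
  -- From `hac`, `a ≤ (4 |S| / 9) c`.
  have hδ : 1 / (4 * S.card) * a ≤ 1 / 9 * c := by
    rw [div_mul_eq_mul_div, one_mul, div_le_iff₀ (by positivity)]
    linarith
  have h1 : l1Norm x = ∑ i ∈ S, ‖x i‖ := by
    refine (Finset.sum_subset (Finset.subset_univ S) fun j _ hj => ?_).symm
    rw [hx j hj, norm_zero]
  have h2 : l1Norm (x + h) = ∑ i ∈ S, ‖x i + h i‖ + c := by
    rw [l1Norm, ← Finset.sum_add_sum_compl S]
    refine congrArg₂ _ rfl (Finset.sum_congr rfl fun i hi => ?_)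
    rw [Pi.add_apply, hx i (Finset.mem_compl.1 hi), zero_add]
  have h3 : ∑ i ∈ S, ‖x i‖ + (∑ i ∈ S, star (signVec x i) * h i).re ≤ ∑ i ∈ S, ‖x i + h i‖ := by
    rw [Complex.re_sum, ← Finset.sum_add_distrib]
    exact Finset.sum_le_sum fun i _ => norm_add_re_star_signVec_mul_le x h i
  rw [h1, h2]
  linarith

theorem isUniqueL1Solution_of_lt {n m : ℕ} {A : Matrix (Fin m) (Fin n) ℂ} {x : Fin n → ℂ}
    (h : ∀ z, A.mulVec z = A.mulVec x → z ≠ x → l1Norm x < l1Norm z) :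
    IsUniqueL1Solution A x := by
  intro z
  constructor
  · rintro ⟨hz, hmin⟩
    by_contra hne
    exact absurd (hmin x rfl) (not_le.2 (h z hz hne))
  · rintro rfl
    refine ⟨rfl, fun w hw => ?_⟩
    by_cases hwz : w = z
    · rw [hwz]
    · exact (h w hw hwz).le

/-- Each row of the sensing matrix is a nonzero multiple of some `a_k^*`, so its kernel is
orthogonal to every drawn measurement vector. -/
theorem sum_star_mul_eq_zero_of_mem_drawnSpan {n m M L : ℕ} {A₀ : Matrix (Fin n) (Fin n) ℂ}
    {π : Fin n → ℝ} (hπ : ∀ k, 0 < π k) (hm : 0 < m) {κ : Fin m → Fin n}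
    {b : Fin L → Fin M → Fin n} (hb : ∀ l j, ∃ i, b l j = κ i) {h : Fin n → ℂ}
    (hh : (sensingMatrix A₀ π κ).mulVec h = 0) {v : Fin n → ℂ} (hv : v ∈ drawnSpan A₀ b) :
    ∑ i, star (v i) * h i = 0 := by
  refine Submodule.span_induction ?_ ?_ ?_ ?_ hv
  · rintro a ⟨l, j, rfl⟩
    obtain ⟨i, hi⟩ := hb l j
    rw [hi]
    have := congrFun hh i
    simp only [Matrix.mulVec, dotProduct, sensingMatrix, mul_assoc, ← Finset.mul_sum,
      Pi.zero_apply, mul_eq_zero] at this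
    refine this.resolve_left ?_
    have h1 : (0 : ℝ) < m := by exact_mod_cast hm
    have h2 := hπ (κ i)
    exact_mod_cast (by positivity : (0 : ℝ) < 1 / √(m : ℝ) * (1 / √(π (κ i)))).ne'
  · simp
  · intro v w _ _ h1 h2
    simp only [Pi.add_apply, star_add, add_mul, Finset.sum_add_distrib, h1, h2, add_zero]
  · intro c v _ h1
    simp only [Pi.smul_apply, smul_eq_mul, star_mul', mul_assoc, ← Finset.mul_sum, h1, mul_zero]

/-- The vectors for which approximate certificates are built: the sign of `x` and the coordinate
vectors of its support. -/
noncomputable def certificateTarget {n : ℕ} (S : Finset (Fin n)) (x : Fin n → ℂ) :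
    Option S → Fin n → ℂ
  | none => signVec x
  | some j => Pi.single (j : Fin n) 1

theorem certificateTarget_eq_zero {n : ℕ} {S : Finset (Fin n)} {x : Fin n → ℂ}
    (hx : ∀ i, i ∉ S → x i = 0) (o : Option S) {i : Fin n} (hi : i ∉ S) :
    certificateTarget S x o i = 0 := by
  rcases o with _ | j
  · simp [certificateTarget, signVec, hx i hi]
  · have : i ≠ j := fun h => hi (h ▸ j.2)
    simp [certificateTarget, this]

theorem norm_certificateTarget_le {n : ℕ} (S : Finset (Fin n)) (x : Fin n → ℂ) (o : Option S)
    (i : Fin n) : ‖certificateTarget S x o i‖ ≤ 1 := by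
  rcases o with _ | j
  · exact norm_signVec_le x i
  · by_cases h : i = j
    · simp [certificateTarget, h]
    · simp [certificateTarget, h]

theorem isUniqueL1Solution_of_certificates {n m M L : ℕ} {A₀ : Matrix (Fin n) (Fin n) ℂ}
    {π : Fin n → ℝ} (hπ : ∀ k, 0 < π k) (hm : 0 < m) {κ : Fin m → Fin n}
    {b : Fin L → Fin M → Fin n} (hb : ∀ l j, ∃ i, b l j = κ i) {S : Finset (Fin n)}
    (hS0 : 0 < S.card) (hL : 4 * S.card ≤ 4 ^ L) {x : Fin n → ℂ} (hx : ∀ i, i ∉ S → x i = 0)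
    (hcert : ∀ o, ∃ v ∈ drawnSpan A₀ b,
      IsApproxCertificate S (certificateTarget S x o) v (1 / 4 ^ L) (1 / 3)) :
    IsUniqueL1Solution (sensingMatrix A₀ π κ) x := by
  have hs : (0 : ℝ) < S.card := by exact_mod_cast hS0
  have hL' : (1 : ℝ) / 4 ^ L ≤ 1 / (4 * S.card) :=
    one_div_le_one_div_of_le (by positivity) (by exact_mod_cast hL)
  have hcert' : ∀ o, ∃ v ∈ drawnSpan A₀ b,
      IsApproxCertificate S (certificateTarget S x o) v (1 / (4 * S.card)) (1 / 3) := by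
    intro o
    obtain ⟨v, hv, h1, h2⟩ := hcert o
    exact ⟨v, hv, fun i hi => (h1 i hi).trans hL', h2⟩
  refine isUniqueL1Solution_of_lt fun z hz hne => ?_
  have hh : (sensingMatrix A₀ π κ).mulVec (z - x) = 0 := by
    rw [Matrix.mulVec_sub, hz, sub_self]
  have := l1Norm_lt_of_certificates hS0 hx (sub_ne_zero.2 hne)
    (fun v hv => sum_star_mul_eq_zero_of_mem_drawnSpan hπ hm hb hh hv) (hcert' none)
    (fun j hj => hcert' (some ⟨j, hj⟩))
  rwa [add_sub_cancel] at this

/-! ### Independent draws -/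

theorem measureReal_draw_eq {Ω : Type*} [MeasurableSpace Ω] {P : Measure Ω} {n m : ℕ}
    {π : Fin n → ℝ} {K : Fin m → Ω → Fin n} (hK : IsIIDDraw P π K) {ι : Type*} [Fintype ι]
    {φ : ι → Fin m} (hφ : Function.Injective φ) (κ : ι → Fin n) :
    P.real {ω | ∀ i, K (φ i) ω = κ i} = ∏ i, π (κ i) := by
  have h := (hK.indep.precomp hφ).measure_inter_preimage_eq_mul Finset.univ
    (sets := fun i => {κ i}) (fun i _ => MeasurableSet.singleton _)
  have hset : {ω | ∀ i, K (φ i) ω = κ i} = ⋂ i ∈ Finset.univ, K (φ i) ⁻¹' {κ i} := by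
    ext ω
    simp
  rw [Measure.real, hset, h, ENNReal.toReal_prod]
  exact Finset.prod_congr rfl fun i _ => hK.law (φ i) (κ i)

/-- The event is a finite union of cylinders, each of which has the product weight by independence;
injectivity of `φ` ensures that no draw is used twice. -/
theorem measureReal_blocks_le {Ω : Type*} [MeasurableSpace Ω] {P : Measure Ω}
    [IsProbabilityMeasure P] {n m L M : ℕ} {π : Fin n → ℝ} {K : Fin m → Ω → Fin n}
    (hK : IsIIDDraw P π K) {φ : Fin L × Fin M → Fin m} (hφ : Function.Injective φ)
    (E : Set (Fin L → Fin M → Fin n)) :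
    P.real {ω | (fun l j => K (φ (l, j)) ω) ∈ E} ≤ weight (prodWeight (prodWeight π M) L) E := by
  classical
  have hset : {ω | (fun l j => K (φ (l, j)) ω) ∈ E}
      = ⋃ b ∈ Finset.univ.filter (· ∈ E), {ω | ∀ w, K (φ w) ω = b w.1 w.2} := by
    ext ω
    simp only [Set.mem_ofPred_eq, Finset.mem_filter, Finset.mem_univ, true_and, Set.mem_iUnion,
      exists_prop]
    constructor
    · intro h
      exact ⟨_, h, fun w => rfl⟩
    · rintro ⟨b, hb, h⟩
      have : (fun l j => K (φ (l, j)) ω) = b := by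
        ext1 l
        ext1 j
        exact h (l, j)
      rwa [this]
  rw [hset, weight]
  refine (measureReal_biUnion_finset_le _ _).trans (le_of_eq ?_)
  rw [Finset.sum_filter]
  refine Finset.sum_congr rfl fun b _ => ?_
  rw [Set.indicator_apply, measureReal_draw_eq hK hφ, Fintype.prod_prod_type]
  rfl

/-! ### The number of measurements -/

theorem norm_le_linftyNorm {n : ℕ} (v : Fin n → ℂ) (i : Fin n) : ‖v i‖ ≤ linftyNorm v :=
  le_ciSup (f := fun j => ‖v j‖) (Set.finite_range _).bddAbove i

theorem normSq_le_iSup_mul {n : ℕ} (A₀ : Matrix (Fin n) (Fin n) ℂ) {π : Fin n → ℝ}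
    (hπ : ∀ k, 0 < π k) (k i : Fin n) :
    ‖A₀ k i‖ ^ 2 ≤ (⨆ k, linftyNorm (measVec A₀ k) ^ 2 / π k) * π k := by
  have h1 : ‖A₀ k i‖ ≤ linftyNorm (measVec A₀ k) := by
    rw [← norm_measVec]
    exact norm_le_linftyNorm _ i
  refine (pow_le_pow_left₀ (norm_nonneg _) h1 2).trans ((div_le_iff₀ (hπ k)).1 ?_)
  exact le_ciSup (f := fun k => linftyNorm (measVec A₀ k) ^ 2 / π k) (Set.finite_range _).bddAbove k

/-- A column of a unitary matrix has unit norm. This lower bound keeps the block length large enough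
to absorb rounding. -/
theorem one_le_of_normSq_le {n : ℕ} (hn : 0 < n) {A₀ : Matrix (Fin n) (Fin n) ℂ}
    (hA : A₀ ∈ Matrix.unitaryGroup (Fin n) ℂ) {π : Fin n → ℝ} (hπ : ∑ k, π k = 1) {B : ℝ}
    (hB : ∀ k i, ‖A₀ k i‖ ^ 2 ≤ B * π k) : 1 ≤ B := by
  let i : Fin n := ⟨0, hn⟩
  have h0 : ∑ j, ‖(Pi.single i 1 : Fin n → ℂ) j‖ ^ 2 = 1 := by
    rw [Finset.sum_eq_single i (fun j _ hj => by simp [hj]) (by simp), Pi.single_eq_same, norm_one,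
      one_pow]
  have h1 := (sum_normSq_mulVec hA (Pi.single i 1)).trans h0
  calc (1 : ℝ) = ∑ k, ‖A₀ k i‖ ^ 2 := by
        rw [← h1]
        simp
    _ ≤ ∑ k, B * π k := Finset.sum_le_sum fun k _ => hB k i
    _ = B := by rw [← Finset.mul_sum, hπ, mul_one]

/-- For `s ≥ 2` the left side is at most `3 log₂ s`, and `3 / ln 2 < 5`. -/
theorem natLog_two_add_two_le {s : ℕ} (hs : 2 ≤ s) :
    ((Nat.log 2 s + 2 : ℕ) : ℝ) ≤ 5 * Real.log s := by
  have h1 : ((2 ^ Nat.log 2 s : ℕ) : ℝ) ≤ s := by exact_mod_cast Nat.pow_log_le_self 2 (by omega)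
  have h2 := Real.log_le_log (by positivity) h1
  push_cast at h2
  rw [Real.log_pow] at h2
  have h3 : Real.log 2 ≤ Real.log s := Real.log_le_log (by norm_num) (by exact_mod_cast hs)
  have h4 := Real.log_two_gt_d9
  push_cast
  nlinarith

theorem four_mul_le_four_pow_log {s : ℕ} : 4 * s ≤ 4 ^ (Nat.log 2 s + 2) := by
  have h1 : s < 2 ^ (Nat.log 2 s + 1) := Nat.lt_pow_succ_log_self (by norm_num) s
  have h2 : 2 ^ (Nat.log 2 s + 1) ≤ 4 ^ (Nat.log 2 s + 1) := Nat.pow_le_pow_left (by norm_num) _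
  rw [pow_succ 4 (Nat.log 2 s + 1)]
  omega

/-- The failure probability of the golfing scheme with `⌊log₂ s⌋ + 2` blocks. -/
theorem failure_bound {n s m : ℕ} {B ε : ℝ} (hs : 2 ≤ s) (hsn : s ≤ n) (hB : 1 ≤ B) (hε : 0 < ε)
    (hε1 : ε < 1) (hm : 10000 * s * B * Real.log s * Real.log (n / ε) ≤ m) :
    0 < m / (Nat.log 2 s + 2) ∧
      ((s : ℝ) + 1) * ((Nat.log 2 s + 2 : ℕ) *
        (4 * n * Real.exp (-((m / (Nat.log 2 s + 2) : ℕ) / (256 * (B * s)))))) ≤ ε := by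
  have hL5 := natLog_two_add_two_le hs
  have hLs : Nat.log 2 s + 2 ≤ 2 * n := by
    have := Nat.log_lt_self 2 (x := s) (by omega)
    omega
  set L := Nat.log 2 s + 2 with hL
  have hL0 : 0 < L := by omega
  have hLr : (0 : ℝ) < L := by exact_mod_cast hL0
  have hs2 : (2 : ℝ) ≤ s := by exact_mod_cast hs
  have hn2 : (2 : ℝ) ≤ n := by exact_mod_cast hs.trans hsn
  have hsn' : (s : ℝ) ≤ n := by exact_mod_cast hsn
  have hne : (2 : ℝ) ≤ n / ε := by
    rw [le_div_iff₀ hε]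
    nlinarith
  have hℓ : 0.69 ≤ Real.log (n / ε) :=
    le_trans (by linarith [Real.log_two_gt_d9]) (Real.log_le_log (by norm_num) hne)
  set ℓ := Real.log (n / ε) with hℓdef
  have hD : 2 ≤ B * s := by nlinarith
  set D := B * s with hDdef
  have hDℓ : 1.38 ≤ D * ℓ := by nlinarith
  have hmL : 2000 * (D * ℓ) * L ≤ m := by
    refine le_trans ?_ hm
    have : 0 ≤ D * ℓ := by linarith
    calc 2000 * (D * ℓ) * L ≤ 2000 * (D * ℓ) * (5 * Real.log s) := by gcongr
      _ = 10000 * s * B * Real.log s * ℓ := by rw [hDdef]; ring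
  have hfloor : (m : ℝ) < ((m / L : ℕ) + 1) * L := by
    have := Nat.lt_div_mul_add (a := m) hL0
    have : m < (m / L + 1) * L := by rw [add_mul, one_mul]; exact this
    exact_mod_cast this
  have hM : 2000 * (D * ℓ) < (m / L : ℕ) + 1 := lt_of_mul_lt_mul_right (hmL.trans_lt hfloor) hLr.le
  constructor
  · have : (0 : ℝ) < (m / L : ℕ) := by linarith
    exact_mod_cast this
  -- Here `7 * 256 = 1792 < 2000`; the surplus `208 D ℓ` exceeds the 1 lost to the floor.
  have hexp : Real.exp (-((m / L : ℕ) / (256 * D))) ≤ (ε / n) ^ 7 := by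
    have h1 : 7 * ℓ ≤ (m / L : ℕ) / (256 * D) := by
      rw [le_div_iff₀ (by linarith)]
      linarith
    have h2 : (ε / n) ^ 7 = Real.exp (-(7 * ℓ)) := by
      have h3 : ε / n = Real.exp (-ℓ) := by
        rw [Real.exp_neg, hℓdef, Real.exp_log (by linarith), inv_div]
      rw [h3, ← Real.exp_nat_mul]
      congr 1
      push_cast
      ring
    rw [h2]
    exact Real.exp_le_exp.2 (by linarith)
  have hLn : (L : ℝ) ≤ 2 * n := by exact_mod_cast hLs
  -- Both `s + 1` and `L` are at most `2 n`, so the prefactor is at most `16 n³`; seven powers of `1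
  -- / n` absorb it because `n ≥ 2`.
  calc ((s : ℝ) + 1) * (L * (4 * n * Real.exp (-((m / L : ℕ) / (256 * D)))))
      ≤ (2 * n) * ((2 * n) * (4 * n * (ε / n) ^ 7)) := by
        gcongr
        linarith
    _ = 2 ^ 4 / (n : ℝ) ^ 4 * ε ^ 7 := by
        have : (n : ℝ) ≠ 0 := by linarith
        field_simp
        norm_num
    _ ≤ 1 * ε ^ 7 := by
        gcongr
        exact (div_le_one (by positivity)).2 (pow_le_pow_left₀ (by norm_num) hn2 4)
    _ ≤ ε := by
        rw [one_mul]
        exact pow_le_of_le_one hε.le hε1.le (by norm_num)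

/-- Recovery with high probability, for an arbitrary drawing distribution. -/
theorem recovery_of_measurementBound_le {n : ℕ} {A₀ : Matrix (Fin n) (Fin n) ℂ}
    (hA : A₀ ∈ Matrix.unitaryGroup (Fin n) ℂ) {s : ℕ} (hs : 2 ≤ s) {S : Finset (Fin n)}
    (hS : S.card = s) {x : Fin n → ℂ} (hx : ∀ i, i ∉ S → x i = 0) {ε : ℝ} (hε : 0 < ε)
    (hε1 : ε < 1) {π : Fin n → ℝ} (hπ : IsDrawingDistribution π) {m : ℕ}
    (hm : measurementBound 10000 s ε A₀ π ≤ m) {Ω : Type*} [MeasurableSpace Ω] (P : Measure Ω)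
    [IsProbabilityMeasure P] {K : Fin m → Ω → Fin n} (hK : IsIIDDraw P π K) :
    1 - ε ≤ P.real {ω | IsUniqueL1Solution (sensingMatrix A₀ π (fun l => K l ω)) x} := by
  have hsn : s ≤ n := by
    have := S.card_le_univ
    rwa [hS, Fintype.card_fin] at this
  set B := ⨆ k, linftyNorm (measVec A₀ k) ^ 2 / π k with hBdef
  have hB : ∀ k i, ‖A₀ k i‖ ^ 2 ≤ B * π k := normSq_le_iSup_mul A₀ hπ.pos
  have hB1 : 1 ≤ B := one_le_of_normSq_le (by omega) hA hπ.sum_eq_one hB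
  obtain ⟨hM, hfail⟩ := failure_bound hs hsn hB1 hε hε1 hm
  set L := Nat.log 2 s + 2 with hL
  set M := m / L with hMdef
  have hS0 : 0 < S.card := by omega
  have hSB : 0 < B * S.card := by
    have : (0 : ℝ) < S.card := by exact_mod_cast hS0
    positivity
  have hm0 : 0 < m := Nat.pos_of_ne_zero fun h => by simp [hMdef, h] at hM
  have hLM : L * M ≤ m := Nat.mul_div_le m L
  -- The first `L * M` draws are cut into blocks. The leftover draws only add constraints on the
  -- kernel.
  let φ : Fin L × Fin M → Fin m := fun w => Fin.castLE hLM (finProdFinEquiv w)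
  have hφ : Function.Injective φ := (Fin.castLE_injective hLM).comp finProdFinEquiv.injective
  let E : Option S → Set (Fin L → Fin M → Fin n) := fun o =>
    {b | ¬ ∃ v ∈ drawnSpan A₀ b,
      IsApproxCertificate S (certificateTarget S x o) v (1 / 4 ^ L) (1 / 3)}
  have hp : ∀ κ, 0 ≤ prodWeight π M κ := prodWeight_nonneg (fun k => (hπ.pos k).le) M
  have hE : weight (prodWeight (prodWeight π M) L) (⋃ o, E o) ≤ ε := by
    refine (weight_iUnion_le (prodWeight_nonneg hp L) E).trans (le_trans ?_ hfail)
    refine (Finset.sum_le_sum fun o _ => weight_no_certificate_le hA hπ hB hSB hM L one_pos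
      (fun i hi => certificateTarget_eq_zero hx o hi) (norm_certificateTarget_le S x o)).trans
        (le_of_eq ?_)
    simp [Finset.sum_const, Fintype.card_option, hS]
  have hfail' := (measureReal_blocks_le hK hφ (⋃ o, E o)).trans hE
  -- Covering the whole space and using subadditivity avoids any measurability claim about the
  -- recovery event.
  have hcover : (Set.univ : Set Ω)
      ⊆ {ω | IsUniqueL1Solution (sensingMatrix A₀ π (fun l => K l ω)) x}
        ∪ {ω | (fun l j => K (φ (l, j)) ω) ∈ ⋃ o, E o} := by
    intro ω _
    by_cases h : (fun l j => K (φ (l, j)) ω) ∈ ⋃ o, E o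
    · exact Or.inr h
    · refine Or.inl (isUniqueL1Solution_of_certificates hπ.pos hm0 (M := M) (L := L)
        (b := fun l j => K (φ (l, j)) ω) (fun l j => ⟨φ (l, j), rfl⟩) hS0 ?_ hx fun o => ?_)
      · rw [hS]
        exact four_mul_le_four_pow_log
      · by_contra ho
        exact h (Set.mem_iUnion.2 ⟨o, ho⟩)
  have h1 := (measureReal_mono (μ := P) hcover).trans (measureReal_union_le _ _)
  rw [probReal_univ] at h1
  linarith

/-! ### The optimal drawing distribution -/

theorem linftyNorm_measVec_pos {n : ℕ} {A₀ : Matrix (Fin n) (Fin n) ℂ}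
    (hA : A₀ ∈ Matrix.unitaryGroup (Fin n) ℂ) (k : Fin n) : 0 < linftyNorm (measVec A₀ k) := by
  by_contra h
  have h0 : ∀ i, A₀ k i = 0 := fun i => norm_le_zero_iff.1 <| by
    rw [← norm_measVec]
    exact (norm_le_linftyNorm _ i).trans (not_lt.1 h)
  have h1 := congrFun (congrFun (Matrix.mem_unitaryGroup_iff.1 hA) k) k
  simp [Matrix.mul_apply, h0] at h1

theorem sum_linftyNorm_sq_pos {n : ℕ} (hn : 0 < n) {A₀ : Matrix (Fin n) (Fin n) ℂ}
    (hA : A₀ ∈ Matrix.unitaryGroup (Fin n) ℂ) : 0 < ∑ k, linftyNorm (measVec A₀ k) ^ 2 :=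
  Finset.sum_pos (fun k _ => pow_pos (linftyNorm_measVec_pos hA k) 2) ⟨⟨0, hn⟩, Finset.mem_univ _⟩

theorem isDrawingDistribution_optimalDrawing {n : ℕ} (hn : 0 < n) {A₀ : Matrix (Fin n) (Fin n) ℂ}
    (hA : A₀ ∈ Matrix.unitaryGroup (Fin n) ℂ) : IsDrawingDistribution (optimalDrawing A₀) where
  pos k := div_pos (pow_pos (linftyNorm_measVec_pos hA k) 2) (sum_linftyNorm_sq_pos hn hA)
  sum_eq_one := by
    simp only [optimalDrawing]
    rw [← Finset.sum_div, div_self (sum_linftyNorm_sq_pos hn hA).ne']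

theorem div_optimalDrawing {n : ℕ} {A₀ : Matrix (Fin n) (Fin n) ℂ}
    (hA : A₀ ∈ Matrix.unitaryGroup (Fin n) ℂ) (k : Fin n) :
    linftyNorm (measVec A₀ k) ^ 2 / optimalDrawing A₀ k
      = ∑ l, linftyNorm (measVec A₀ l) ^ 2 :=
  div_div_cancel₀ (pow_pos (linftyNorm_measVec_pos hA k) 2).ne'

theorem iSup_div_optimalDrawing {n : ℕ} (hn : 0 < n) {A₀ : Matrix (Fin n) (Fin n) ℂ}
    (hA : A₀ ∈ Matrix.unitaryGroup (Fin n) ℂ) :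
    ⨆ k, linftyNorm (measVec A₀ k) ^ 2 / optimalDrawing A₀ k
      = ∑ l, linftyNorm (measVec A₀ l) ^ 2 := by
  have : Nonempty (Fin n) := ⟨⟨0, hn⟩⟩
  simp only [div_optimalDrawing hA, ciSup_const]

/-- Two distinct vectors with the same sum cannot be ordered entrywise, so `π k` is below the
optimal value for some `k`. There the ratio exceeds the constant ratio of the optimal drawing. -/
theorem sum_lt_iSup_div {n : ℕ} (hn : 0 < n) {A₀ : Matrix (Fin n) (Fin n) ℂ}
    (hA : A₀ ∈ Matrix.unitaryGroup (Fin n) ℂ) {π : Fin n → ℝ} (hπ : IsDrawingDistribution π)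
    (hne : π ≠ optimalDrawing A₀) :
    ∑ l, linftyNorm (measVec A₀ l) ^ 2 < ⨆ k, linftyNorm (measVec A₀ k) ^ 2 / π k := by
  obtain ⟨k, hk⟩ : ∃ k, π k < optimalDrawing A₀ k := by
    by_contra! hle
    refine hne (funext fun k => ?_)
    have hsum : ∑ k, optimalDrawing A₀ k = ∑ k, π k := by
      rw [(isDrawingDistribution_optimalDrawing hn hA).sum_eq_one, hπ.sum_eq_one]
    exact ((Finset.sum_eq_sum_iff_of_le fun k _ => hle k).1 hsum k (Finset.mem_univ k)).symm
  rw [← div_optimalDrawing hA k]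
  refine (div_lt_div_of_pos_left (pow_pos (linftyNorm_measVec_pos hA k) 2) (hπ.pos k) hk).trans_le ?_
  exact le_ciSup (f := fun k => linftyNorm (measVec A₀ k) ^ 2 / π k) (Set.finite_range _).bddAbove k

end IsolatedSensing

theorem mainTheorem8 :
    ∃ C : ℝ, 0 < C ∧
      ∀ (n : ℕ) (A₀ : Matrix (Fin n) (Fin n) ℂ), A₀ ∈ Matrix.unitaryGroup (Fin n) ℂ →
      ∀ (s : ℕ), 2 ≤ s →
      ∀ (S : Finset (Fin n)), S.card = s →
      ∀ (x : Fin n → ℂ), (∀ i, i ∉ S → x i = 0) →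
      ∀ (ε : ℝ), 0 < ε → ε < 1 →
        -- recovery for an arbitrary drawing distribution
        (∀ π : Fin n → ℝ, IsolatedSensing.IsDrawingDistribution π →
          ∀ (m : ℕ), IsolatedSensing.measurementBound C s ε A₀ π ≤ m →
          ∀ (Ω : Type u) [MeasurableSpace Ω] (P : Measure Ω) [IsProbabilityMeasure P]
            (K : Fin m → Ω → Fin n), IsolatedSensing.IsIIDDraw P π K →
            1 - ε ≤ P.real {ω | IsolatedSensing.IsUniqueL1Solution
              (IsolatedSensing.sensingMatrix A₀ π (fun l => K l ω)) x}) ∧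
        -- the unique drawing distribution that minimizes the bound, and the minimal value
        IsolatedSensing.IsDrawingDistribution (IsolatedSensing.optimalDrawing A₀) ∧
        (∀ π : Fin n → ℝ, IsolatedSensing.IsDrawingDistribution π →
          π ≠ IsolatedSensing.optimalDrawing A₀ →
          IsolatedSensing.measurementBound C s ε A₀ (IsolatedSensing.optimalDrawing A₀) <
            IsolatedSensing.measurementBound C s ε A₀ π) ∧
        IsolatedSensing.measurementBound C s ε A₀ (IsolatedSensing.optimalDrawing A₀) =
          C * s * (∑ k, IsolatedSensing.linftyNorm (IsolatedSensing.measVec A₀ k) ^ 2) *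
            Real.log s * Real.log (n / ε) ∧
        -- recovery for the minimizing drawing distribution
        (∀ (m : ℕ),
          C * s * (∑ k, IsolatedSensing.linftyNorm (IsolatedSensing.measVec A₀ k) ^ 2) *
            Real.log s * Real.log (n / ε) ≤ m →
          ∀ (Ω : Type u) [MeasurableSpace Ω] (P : Measure Ω) [IsProbabilityMeasure P]
            (K : Fin m → Ω → Fin n),
            IsolatedSensing.IsIIDDraw P (IsolatedSensing.optimalDrawing A₀) K →
            1 - ε ≤ P.real {ω | IsolatedSensing.IsUniqueL1Solution
              (IsolatedSensing.sensingMatrix A₀ (IsolatedSensing.optimalDrawing A₀)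
                (fun l => K l ω)) x}) := by
  refine ⟨10000, by norm_num, ?_⟩
  intro n A₀ hA s hs S hS x hx ε hε hε1
  have hsn : s ≤ n := by
    have := S.card_le_univ
    rwa [hS, Fintype.card_fin] at this
  have hn : 0 < n := by omega
  have hmin : IsolatedSensing.measurementBound 10000 s ε A₀ (IsolatedSensing.optimalDrawing A₀) =
      10000 * s * (∑ k, IsolatedSensing.linftyNorm (IsolatedSensing.measVec A₀ k) ^ 2) *
        Real.log s * Real.log (n / ε) := by
    rw [IsolatedSensing.measurementBound, IsolatedSensing.iSup_div_optimalDrawing hn hA]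
  have hopt := IsolatedSensing.isDrawingDistribution_optimalDrawing hn hA
  refine ⟨?_, hopt, ?_, hmin, ?_⟩
  · intro π hπ m hm Ω _ P _ K hK
    exact IsolatedSensing.recovery_of_measurementBound_le hA hs hS hx hε hε1 hπ hm P hK
  · intro π hπ hne
    rw [hmin, IsolatedSensing.measurementBound]
    -- Both logarithms must be strictly positive for the strict inequality to survive
    -- multiplication.
    have hs1 : (1 : ℝ) < s := by exact_mod_cast hs
    have hne1 : 1 < (n : ℝ) / ε := by
      rw [lt_div_iff₀ hε]
      have : (s : ℝ) ≤ n := by exact_mod_cast hsn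
      linarith
    have h1 := Real.log_pos hs1
    have h2 := Real.log_pos hne1
    gcongr
    exact IsolatedSensing.sum_lt_iSup_div hn hA hπ hne
  · intro m hm Ω _ P _ K hK
    exact IsolatedSensing.recovery_of_measurementBound_le hA hs hS hx hε hε1 hopt
      (hmin.trans_le hm) P hK
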